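/- Let $n\ge 1$ and let $\mathbf H$ be the real quaternions. For $A=(a_{ij})\in M(n,\mathbf H)$, $\sigma\in S_n$ and $x\in\{1,\dots,n\}$ put $A_\sigma(x)=a_{x\,\sigma(x)}\,a_{\sigma(x)\,\sigma^2(x)}\cdots a_{\sigma^{l-1}(x)\,x}$, where $l$ is the length of the cycle of $\sigma$ through $x$. For $1\le i\le n$ let $m_2<\dots<m_r$ be the smallest elements of the cycles of $\sigma$ (fixed points included) that do not contain $i$, and define the $i$-th row and column determinants $$\operatorname{rdet}_i A=\sum_{\sigma\in S_n}\operatorname{sgn}(\sigma)\,A_\sigma(i)A_\sigma(m_2)\cdots A_\sigma(m_r),\qquad \operatorname{cdet}_i A=\sum_{\sigma\in S_n}\operatorname{sgn}(\sigma)\,A_\sigma(m_r)\cdots A_\sigma(m_2)A_\sigma(i).$$ If $M\in M(n,\mathbf H)$ is Hermitian ($M^*=M$), then all the $\operatorname{rdet}_i M$ and $\operatorname{cdet}_i M$, $i=1,\dots,n$, are equal; their common value is denoted $\det M$. For $A\in M(n,\mathbf H)$ the double determinant is $\operatorname{ddet}A:=\det(A^*A)$. Then for all $A,B\in M(n,\mathbf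 H)$, $$\operatorname{ddet}(AB)=\operatorname{ddet}A\cdot\operatorname{ddet}B .$$ -/

import Mathlib

/-- The product of the entries of `A` along the cycle of `σ` through `x`, written from `x`:
`a_{x, σ x} a_{σ x, σ² x} ⋯ a_{σ^{l-1} x, x}`, where `l` is the length of that cycle.
A fixed point `x` contributes the single factor `a_{x x}`. -/
noncomputable def cycleProd {R : Type*} [Ring R] {n : ℕ} (A : Matrix (Fin n) (Fin n) R)
    (σ : Equiv.Perm (Fin n)) (x : Fin n) : R :=
  ((List.range (Function.minimalPeriod σ x)).map
    fun k => A ((σ ^ k) x) ((σ ^ (k + 1)) x)).prod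

/-- The smallest elements of the cycles of `σ` (fixed points included) that do not contain `i`,
listed in increasing order. -/
def otherLeaders {n : ℕ} (σ : Equiv.Perm (Fin n)) (i : Fin n) : List (Fin n) :=
  (List.finRange n).filter fun x => ¬ σ.SameCycle i x ∧ ∀ y, σ.SameCycle x y → x ≤ y

/-- The `i`-th row determinant: in the monomial of `σ` the cycle through `i` comes first (on the
left) and starts at `i`; the other cycles start at their smallest elements and follow, from left
to right, in increasing order of these. -/
noncomputable def rdet {R : Type*} [Ring R] {n : ℕ} (i : Fin n)
    (A : Matrix (Fin n) (Fin n) R) : R :=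
  ∑ σ : Equiv.Perm (Fin n), ((Equiv.Perm.sign σ : ℤ) : R) *
    (cycleProd A σ i * ((otherLeaders σ i).map (cycleProd A σ)).prod)

/-- The `j`-th column determinant: the monomials are written from right to left, so the cycle
through `j` is the rightmost one and ends with a factor `a_{x j}`; the other cycles follow, from
right to left, in increasing order of their smallest elements, each of them having its smallest
element as the first index of its first factor and as the last index of its last factor. -/
noncomputable def cdet {R : Type*} [Ring R] {n : ℕ} (j : Fin n)
    (A : Matrix (Fin n) (Fin n) R) : R :=
  ∑ τ : Equiv.Perm (Fin n), ((Equiv.Perm.sign τ : ℤ) : R) *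
    (((otherLeaders τ j).reverse.map (cycleProd A τ)).prod * cycleProd A τ j)

/-- The determinant of a Hermitian quaternion matrix of positive size. It is the common value of
all row and column determinants; the first row determinant is used as its representative. -/
noncomputable def hermitianDet {n : ℕ} [NeZero n]
    (A : Matrix (Fin n) (Fin n) (Quaternion ℝ)) : Quaternion ℝ :=
  rdet 0 A

/-- The double determinant of a quaternion matrix: the determinant of the Hermitian
matrix `A* A`. -/
noncomputable def ddet {n : ℕ} [NeZero n]
    (A : Matrix (Fin n) (Fin n) (Quaternion ℝ)) : Quaternion ℝ :=
  hermitianDet (A.conjTranspose * A)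

/-!
The row and column determinants are analysed through sums over paths. Let `K(a, b; v)` be the signed
sum of the products of `M` along all paths from `a` to `b` with interior vertex set `v` (`pathSum`),
and let `D(s)` be the determinant on the indices in `s`, with the cycles of each permutation ordered
by their smallest elements (`principalDet`). Removing the first step of a cycle with a transposition
gives `rdet_i M = ∑ v, K(i, i; v) * D(vᶜ \ {i})` over any ring (`rowDetReplace_eq_borderedSum`).

If `M` is Hermitian, reversing paths gives `star K(a, b; v) = K(b, a; v)`. So the closed path sums
are real, and, because `Re (x * y) = Re (y * x)`, they do not depend on the base point. Hence
`D(s)` is a real sum over set partitions of `s` with a weight for each block, and it may be expanded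
along the block of any index (`IsPrincipalDet.insert_eq`). This makes all `rdet_i M` equal to the
real number `D(univ)`; since `cdet_i M` is the conjugate of `rdet_i Mᴴ`, it has the same value.

For the multiplicativity, let `P(a, b; t) = ∑ v ⊆ t, K(a, b; v) * D(t \ v)` (`borderedSum`). It
vanishes if `a` or `b` lies in `t`: the paths through the interior copy of `a` cancel the pairs of a
path avoiding `a` and a disjoint cycle through `a` (`IsPrincipalDet.borderedSum_left_eq_zero`). As
`D(insert j t) = P(j, j; t)` is sesquilinear in the two ends, `D(univ)` does not change when `M` is
replaced by `Tᴴ * M * T` with a transvection `T`. For diagonal `T` it is multiplied by a real factor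
independent of `M`. By elimination over the division ring of quaternions, every `B` is a product of
such matrices, so `D(Bᴴ * M * B) = D(M) * N` with `N` independent of `M`; taking `M = 1` shows that
`N = D(Bᴴ * B)`, and taking `M = Aᴴ * A` gives the product formula.
-/

open Finset

/-! ### Sums over paths -/

section PathSums

variable {ι R : Type*} [DecidableEq ι] [Ring R]

/-- The signed sum of the products of `A` along all paths from `a` to `b` whose intermediate
vertices run exactly once through the finite set `v`; the sign is `(-1) ^ #v`. The ends `a` and
`b` are allowed to lie in `v`. -/
noncomputable def pathSum (A : Matrix ι ι R) (v : Finset ι) (a b : ι) : R :=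
  if v = ∅ then A a b
  else -∑ u : {u // u ∈ v}, A a u * pathSum A (v.erase u) u b
termination_by v.card
decreasing_by exact card_erase_lt_of_mem u.2

@[simp]
theorem pathSum_empty (A : Matrix ι ι R) (a b : ι) : pathSum A ∅ a b = A a b := by
  rw [pathSum]; simp

theorem pathSum_of_nonempty (A : Matrix ι ι R) {v : Finset ι} (hv : v.Nonempty) (a b : ι) :
    pathSum A v a b = -∑ u ∈ v, A a u * pathSum A (v.erase u) u b := by
  rw [pathSum, if_neg hv.ne_empty, ← Finset.sum_coe_sort v]

/-- The sum over pairs of a subset `w` of `t` and a point `u ∈ w`, indexed by `u` and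
`w.erase u` instead. -/
theorem sum_powerset_sum_mem {M : Type*} [AddCommMonoid M] (t : Finset ι)
    (f : ι → Finset ι → M) :
    ∑ w ∈ t.powerset, ∑ u ∈ w, f u (w.erase u) = ∑ u ∈ t, ∑ w ∈ (t.erase u).powerset, f u w := by
  rw [sum_sigma', sum_sigma']
  refine sum_bij' (fun p _ => ⟨p.2, p.1.erase p.2⟩) (fun p _ => ⟨insert p.1 p.2, p.1⟩) ?_ ?_ ?_ ?_ ?_
  · rintro ⟨w, u⟩ h
    simp only [mem_sigma, mem_powerset] at h ⊢
    exact ⟨h.1 h.2, erase_subset_erase _ h.1⟩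
  · rintro ⟨u, w⟩ h
    simp only [mem_sigma, mem_powerset] at h ⊢
    exact ⟨insert_subset h.1 (h.2.trans (erase_subset _ _)), mem_insert_self _ _⟩
  · rintro ⟨w, u⟩ h
    simp only [mem_sigma, mem_powerset] at h
    simp [insert_erase h.2]
  · rintro ⟨u, w⟩ h
    simp only [mem_sigma, mem_powerset] at h
    have : u ∉ w := fun hu => by simpa using h.2 hu
    simp [erase_insert this]
  · intros; rfl

theorem sum_powerset_compl {M : Type*} [AddCommMonoid M] (t : Finset ι)
    (f : Finset ι → Finset ι → M) :
    ∑ w ∈ t.powerset, f w (t \ w) = ∑ w ∈ t.powerset, f (t \ w) w := by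
  refine sum_bij' (fun w _ => t \ w) (fun w _ => t \ w) ?_ ?_ ?_ ?_ ?_
  · intro w _; simp
  · intro w _; simp
  · intro w h; simpa using h
  · intro w h; simpa using h
  · intro w h; rw [Finset.sdiff_sdiff_eq_self (mem_powerset.1 h)]

/-- Choosing disjoint `v` and `w` inside `t` in either order. -/
theorem sum_powerset_sdiff_comm {M : Type*} [AddCommMonoid M] (t : Finset ι)
    (f : Finset ι → Finset ι → Finset ι → M) :
    ∑ v ∈ t.powerset, ∑ w ∈ (t \ v).powerset, f v w ((t \ v) \ w) =
      ∑ w ∈ t.powerset, ∑ v ∈ (t \ w).powerset, f v w ((t \ w) \ v) := by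
  have h : ∀ v w : Finset ι, (v ∈ t.powerset ∧ w ∈ (t \ v).powerset) ↔
      (v ∈ (t \ w).powerset ∧ w ∈ t.powerset) := by
    intro v w
    simp only [mem_powerset, subset_sdiff]
    exact ⟨fun h => ⟨⟨h.1, h.2.2.symm⟩, h.2.1⟩, fun h => ⟨h.1.1, h.2, h.1.2.symm⟩⟩
  rw [sum_comm' h]
  refine sum_congr rfl fun w _ => sum_congr rfl fun v _ => ?_
  rw [sdiff_sdiff_left, sdiff_sdiff_left, sup_comm]

/-- Ordered splittings of `t` into three parts, built up in two ways. -/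
theorem sum_powerset_assoc {M : Type*} [AddCommMonoid M] (t : Finset ι)
    (f : Finset ι → Finset ι → Finset ι → M) :
    ∑ v ∈ t.powerset, ∑ w ∈ v.powerset, f w (v \ w) (t \ v) =
      ∑ w ∈ t.powerset, ∑ v ∈ (t \ w).powerset, f w v ((t \ w) \ v) := by
  rw [sum_sigma', sum_sigma']
  refine sum_bij' (fun p _ => ⟨p.2, p.1 \ p.2⟩) (fun p _ => ⟨p.1 ∪ p.2, p.1⟩) ?_ ?_ ?_ ?_ ?_
  · rintro ⟨v, w⟩ h
    simp only [mem_sigma, mem_powerset] at h ⊢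
    exact ⟨h.2.trans h.1, sdiff_subset_sdiff h.1 subset_rfl⟩
  · rintro ⟨w, v⟩ h
    simp only [mem_sigma, mem_powerset] at h ⊢
    exact ⟨union_subset h.1 (h.2.trans sdiff_subset), subset_union_left⟩
  · rintro ⟨v, w⟩ h
    simp only [mem_sigma, mem_powerset] at h
    simp [union_sdiff_of_subset h.2]
  · rintro ⟨w, v⟩ h
    simp only [mem_sigma, mem_powerset, subset_sdiff] at h
    simp [union_sdiff_cancel_left h.2.2.symm]
  · rintro ⟨v, w⟩ h
    simp only [mem_sigma, mem_powerset] at h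
    simp only [sdiff_sdiff_left, sup_eq_union, union_sdiff_of_subset h.2]

/-- Cutting every path at the vertex `k`. Both parts carry their own sign, so the one for `k` itself
is left over. -/
theorem pathSum_insert (A : Matrix ι ι R) {k : ι} {v : Finset ι} (hk : k ∉ v) (a b : ι) :
    pathSum A (insert k v) a b =
      -∑ w ∈ v.powerset, pathSum A w a k * pathSum A (v \ w) k b := by
  induction v using Finset.strongInduction generalizing a with
  | H v ih =>
    have key : ∀ w ∈ v.powerset, pathSum A w a k * pathSum A (v \ w) k b =
        (if w = ∅ then A a k * pathSum A v k b else 0) -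
          ∑ u ∈ w, A a u * pathSum A (w.erase u) u k *
            pathSum A ((v.erase u) \ (w.erase u)) k b := by
      intro w hw
      rcases w.eq_empty_or_nonempty with rfl | hne
      · simp
      · rw [if_neg hne.ne_empty, pathSum_of_nonempty A hne, neg_mul, sum_mul, zero_sub]
        congr 1
        refine sum_congr rfl fun u hu => ?_
        congr 2
        ext x
        have := mem_powerset.1 hw hu
        simp only [mem_sdiff, mem_erase]
        by_cases hx : x = u <;> simp [hx, hu]
    rw [pathSum_of_nonempty A (insert_nonempty _ _), sum_insert hk, erase_insert hk,
      sum_congr rfl key, sum_sub_distrib, sum_ite_eq' , if_pos (empty_mem_powerset v),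
      sum_powerset_sum_mem v
        (fun u w => A a u * pathSum A w u k * pathSum A ((v.erase u) \ w) k b),
      sub_eq_add_neg, ← sum_neg_distrib]
    congr 2
    refine sum_congr rfl fun u hu => ?_
    have hne : k ≠ u := fun h => hk (h ▸ hu)
    rw [erase_insert_of_ne hne, ih _ (erase_ssubset hu) (fun h => hk (mem_of_mem_erase h)),
      mul_neg, mul_sum]
    simp only [mul_assoc]

/-- The sum over all paths from `a` to `b` inside `t`, each weighted with the value of `D` on the
set of vertices of `t` that it leaves out. With `D` the determinants of the principal submatrices
this is, for Hermitian `A`, the determinant on `t` times the Schur complement entry at `(a, b)`. -/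
noncomputable def borderedSum (A : Matrix ι ι R) (D : Finset ι → R) (t : Finset ι) (a b : ι) : R :=
  ∑ v ∈ t.powerset, pathSum A v a b * D (t \ v)

/-- Splitting off the first edge of every path. -/
theorem borderedSum_eq (A : Matrix ι ι R) (D : Finset ι → R) (t : Finset ι) (a b : ι) :
    borderedSum A D t a b =
      A a b * D t - ∑ u ∈ t, A a u * borderedSum A D (t.erase u) u b := by
  have key : ∀ v ∈ t.powerset, pathSum A v a b * D (t \ v) =
      (if v = ∅ then A a b * D t else 0) -
        ∑ u ∈ v, A a u * pathSum A (v.erase u) u b * D ((t.erase u) \ (v.erase u)) := by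
    intro v hv
    rcases v.eq_empty_or_nonempty with rfl | hne
    · simp
    · rw [if_neg hne.ne_empty, pathSum_of_nonempty A hne, neg_mul, sum_mul, zero_sub]
      congr 1
      refine sum_congr rfl fun u hu => ?_
      congr 2
      ext x
      have := mem_powerset.1 hv hu
      simp only [mem_sdiff, mem_erase]
      by_cases hx : x = u <;> simp [hx, hu]
  rw [borderedSum, sum_congr rfl key, sum_sub_distrib, sum_ite_eq',
    if_pos (empty_mem_powerset t),
    sum_powerset_sum_mem t (fun u v => A a u * pathSum A v u b * D ((t.erase u) \ v))]
  simp only [borderedSum, mul_sum, mul_assoc]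

end PathSums

/-! ### Principal determinants of Hermitian matrices -/

section Hermitian

open Quaternion

variable {ι : Type*}

/-- The paths are sorted by whether they avoid the vertex `k` or pass through it. -/
theorem borderedSum_insert {R : Type*} [DecidableEq ι] [Ring R] (A : Matrix ι ι R)
    (D : Finset ι → R) {k : ι} {t : Finset ι} (hk : k ∉ t) (a b : ι) :
    borderedSum A D (insert k t) a b =
      ∑ v ∈ t.powerset, pathSum A v a b * D (insert k (t \ v)) +
        ∑ v ∈ t.powerset, pathSum A (insert k v) a b * D (t \ v) := by
  rw [borderedSum, sum_powerset_insert hk]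
  congr 1
  · refine sum_congr rfl fun v hv => ?_
    rw [insert_sdiff_of_notMem _ fun h => hk (mem_powerset.1 hv h)]
  · refine sum_congr rfl fun v hv => ?_
    rw [insert_sdiff_insert, sdiff_insert_of_notMem hk]

/-- For Hermitian `M`, conjugation reverses all paths. In particular the closed path sums are
self-adjoint, so in the quaternions they are real and central. -/
theorem star_pathSum {R : Type*} [DecidableEq ι] [Ring R] [StarRing R] {M : Matrix ι ι R}
    (hM : M.IsHermitian) (v : Finset ι) (a b : ι) :
    star (pathSum M v a b) = pathSum M v b a := by
  induction v using Finset.strongInduction generalizing a b with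
  | H v ih =>
    rcases v.eq_empty_or_nonempty with rfl | ⟨k, hk⟩
    · simpa using hM.apply b a
    · have hk' := notMem_erase k v
      rw [← insert_erase hk, pathSum_insert M hk', pathSum_insert M hk', star_neg, star_sum]
      simp only [star_mul]
      rw [← sum_powerset_compl (v.erase k)
        (fun w w' => star (pathSum M w k b) * star (pathSum M w' a k))]
      congr 1
      refine sum_congr rfl fun w hw => ?_
      have h1 : w ⊂ v := (mem_powerset.1 hw).trans_ssubset (erase_ssubset hk)
      have h2 : v.erase k \ w ⊂ v := sdiff_subset.trans_ssubset (erase_ssubset hk)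
      rw [ih _ h1, ih _ h2]

theorem Quaternion.mul_comm_of_star_eq_self {x : ℍ[ℝ]} (hx : star x = x) (y : ℍ[ℝ]) :
    x * y = y * x := by
  rw [Quaternion.star_eq_self.1 hx]
  exact Quaternion.coe_commutes _ _

theorem Quaternion.re_mul_comm (x y : ℍ[ℝ]) : (x * y).re = (y * x).re := by
  simp only [Quaternion.re_mul]; ring

section

variable [DecidableEq ι] {M : Matrix ι ι ℍ[ℝ]}

theorem pathSum_self_mul_comm (hM : M.IsHermitian) (v : Finset ι) (a : ι) (y : ℍ[ℝ]) :
    pathSum M v a a * y = y * pathSum M v a a :=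
  Quaternion.mul_comm_of_star_eq_self (star_pathSum hM v a a) y

/-- The sum over all cycles with a given vertex set does not depend on the base point. -/
theorem pathSum_self_insert_swap (hM : M.IsHermitian) {v : Finset ι} {j k : ι} (hj : j ∉ v)
    (hk : k ∉ v) : pathSum M (insert k v) j j = pathSum M (insert j v) k k := by
  have hre : (pathSum M (insert k v) j j).re = (pathSum M (insert j v) k k).re := by
    rw [pathSum_insert M hk, pathSum_insert M hj,
      sum_powerset_compl v (fun w w' => pathSum M w k j * pathSum M w' j k),
      Quaternion.re_neg, Quaternion.re_neg]
    congr 1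
    have h : ∀ f : Finset ι → ℍ[ℝ], (∑ w ∈ v.powerset, f w).re = ∑ w ∈ v.powerset, (f w).re :=
      fun f => map_sum (QuaternionAlgebra.reₗ (R := ℝ) (-1) 0 (-1)) _ _
    rw [h, h]
    exact sum_congr rfl fun w _ => Quaternion.re_mul_comm _ _
  rw [Quaternion.star_eq_self.1 (star_pathSum hM _ j j),
    Quaternion.star_eq_self.1 (star_pathSum hM _ k k), hre]

end

/-- `D` satisfies the recursion for the determinants of the principal submatrices of `M`: split
off the cycle through the smallest index. -/
structure IsPrincipalDet {R : Type*} [LinearOrder ι] [Ring R] (M : Matrix ι ι R)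
    (D : Finset ι → R) : Prop where
  empty : D ∅ = 1
  insert_min : ∀ (m : ι) (t : Finset ι), (∀ x ∈ t, m < x) →
    D (insert m t) = borderedSum M D t m m

/-- Induction that adjoins a new least element `m` to `t`, with the property available for all
subsets of `t`. -/
theorem Finset.strong_induction_on_min [LinearOrder ι] {p : Finset ι → Prop} (s : Finset ι)
    (empty : p ∅)
    (insert : ∀ m t, (∀ x ∈ t, m < x) → (∀ v ⊆ t, p v) → p (insert m t)) : p s := by
  induction s using Finset.strongInduction with
  | H s ih =>
    rcases s.eq_empty_or_nonempty with rfl | hne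
    · exact empty
    · have hm := s.min'_mem hne
      rw [← insert_erase hm]
      exact insert _ _ (fun x hx => min'_lt_of_mem_erase_min' _ _ hx)
        fun v hv => ih v (hv.trans_ssubset (erase_ssubset hm))

namespace IsPrincipalDet

variable [LinearOrder ι] {M : Matrix ι ι ℍ[ℝ]} {D : Finset ι → ℍ[ℝ]}

theorem star_eq (hD : IsPrincipalDet M D) (hM : M.IsHermitian) (s : Finset ι) :
    star (D s) = D s := by
  induction s using Finset.strong_induction_on_min with
  | empty => simp [hD.empty]
  | insert m t hm ih =>
    rw [hD.insert_min m t hm, borderedSum, star_sum]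
    refine sum_congr rfl fun v _ => ?_
    rw [star_mul, star_pathSum hM, ih _ sdiff_subset, pathSum_self_mul_comm hM]

/-- The determinant can be expanded along the cycles through any index `j`. -/
theorem insert_eq (hD : IsPrincipalDet M D) (hM : M.IsHermitian) {t : Finset ι} {j : ι}
    (hj : j ∉ t) : D (insert j t) = borderedSum M D t j j := by
  induction t using Finset.strong_induction_on_min with
  | empty => exact hD.insert_min j ∅ (by simp)
  | insert m t hm ih =>
    have hmt : m ∉ t := fun h => lt_irrefl _ (hm m h)
    rw [mem_insert, not_or] at hj
    rcases lt_or_gt_of_ne hj.1 with hlt | hlt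
    · refine hD.insert_min j _ fun x hx => ?_
      rcases mem_insert.1 hx with rfl | hx
      · exact hlt
      · exact hlt.trans (hm x hx)
    · have hm' : ∀ x ∈ insert j t, m < x := by
        intro x hx
        rcases mem_insert.1 hx with rfl | hx
        · exact hlt
        · exact hm x hx
      rw [Finset.insert_comm, hD.insert_min m _ hm', borderedSum_insert M D hj.2,
        borderedSum_insert M D hmt]
      -- cycles through only one of `m` and `j`, then cycles through both
      congr 1
      · have h1 : ∀ v ∈ t.powerset, pathSum M v m m * D (insert j (t \ v)) =
            ∑ w ∈ (t \ v).powerset, pathSum M v m m * pathSum M w j j * D ((t \ v) \ w) := by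
          intro v _
          rw [ih _ sdiff_subset fun h => hj.2 (mem_sdiff.1 h).1, borderedSum, mul_sum]
          simp only [mul_assoc]
        have h2 : ∀ v ∈ t.powerset, pathSum M v j j * D (insert m (t \ v)) =
            ∑ w ∈ (t \ v).powerset, pathSum M w m m * pathSum M v j j * D ((t \ v) \ w) := by
          intro v _
          rw [hD.insert_min m _ fun x hx => hm x (mem_sdiff.1 hx).1, borderedSum, mul_sum]
          refine sum_congr rfl fun w _ => ?_
          rw [← mul_assoc, pathSum_self_mul_comm hM v]
        rw [sum_congr rfl h1, sum_congr rfl h2]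
        exact sum_powerset_sdiff_comm t
          fun v w r => pathSum M v m m * pathSum M w j j * D r
      · refine sum_congr rfl fun v hv => ?_
        rw [pathSum_self_insert_swap hM (fun h => hmt (mem_powerset.1 hv h))
          (fun h => hj.2 (mem_powerset.1 hv h))]

/-- An analogue of the vanishing of a determinant with two equal rows, the index `a` being used both
as an interior vertex and as an end: the paths that visit the interior
copy of `a` cancel against the pairs of a path and a disjoint cycle through `a`. -/
theorem borderedSum_left_eq_zero (hD : IsPrincipalDet M D) (hM : M.IsHermitian) {t : Finset ι}
    {a : ι} (ha : a ∈ t) (b : ι) : borderedSum M D t a b = 0 := by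
  -- the paths avoiding `a` are paired with a cycle through `a`, those through `a` are cut there
  obtain ⟨t, hat, rfl⟩ : ∃ t', a ∉ t' ∧ insert a t' = t :=
    ⟨t.erase a, notMem_erase _ _, insert_erase ha⟩
  have h1 : ∀ v ∈ t.powerset, pathSum M v a b * D (insert a (t \ v)) =
      ∑ w ∈ (t \ v).powerset, pathSum M w a a * pathSum M v a b * D ((t \ v) \ w) := by
    intro v _
    rw [hD.insert_eq hM fun h => hat (mem_sdiff.1 h).1, borderedSum, mul_sum]
    refine sum_congr rfl fun w _ => ?_
    rw [← mul_assoc, pathSum_self_mul_comm hM w]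
  have h2 : ∀ v ∈ t.powerset, pathSum M (insert a v) a b * D (t \ v) =
      -∑ w ∈ v.powerset, pathSum M w a a * pathSum M (v \ w) a b * D (t \ v) := by
    intro v hv
    rw [pathSum_insert M fun h => hat (mem_powerset.1 hv h), neg_mul, sum_mul]
  rw [borderedSum_insert M D hat, sum_congr rfl h1, sum_congr rfl h2, sum_neg_distrib,
    sum_powerset_assoc t fun w v r => pathSum M w a a * pathSum M v a b * D r,
    sum_powerset_sdiff_comm t fun v w r => pathSum M w a a * pathSum M v a b * D r, add_neg_cancel]

theorem borderedSum_right_eq_zero (hD : IsPrincipalDet M D) (hM : M.IsHermitian) {t : Finset ι}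
    {b : ι} (hb : b ∈ t) (a : ι) : borderedSum M D t a b = 0 := by
  rw [← star_inj, star_zero, ← hD.borderedSum_left_eq_zero hM hb a, borderedSum, star_sum]
  refine sum_congr rfl fun v _ => ?_
  rw [star_mul, star_pathSum hM, hD.star_eq hM,
    Quaternion.mul_comm_of_star_eq_self (hD.star_eq hM _)]

end IsPrincipalDet

end Hermitian

/-! ### Congruence by transvections and diagonal matrices -/

section Congruence

open Quaternion

variable {ι : Type*}

/-- `M'` is the congruence transform `Tᴴ * M * T` of `M` under the transvection
`T = 1 + Matrix.single i j c`, described entrywise. -/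
structure IsTransvectionCongr {R : Type*} [Ring R] [StarRing R] (i j : ι) (c : R)
    (M M' : Matrix ι ι R) : Prop where
  ne_ne : ∀ u w, u ≠ j → w ≠ j → M' u w = M u w
  ne_eq : ∀ u, u ≠ j → M' u j = M u j + M u i * c
  eq_ne : ∀ w, w ≠ j → M' j w = M j w + star c * M i w
  eq_eq : M' j j = M j j + M j i * c + star c * (M i j + M i i * c)

namespace IsTransvectionCongr

variable {R : Type*} [DecidableEq ι] [Ring R] [StarRing R] {i j : ι} {c : R} {M M' : Matrix ι ι R}

theorem pathSum_ne_ne (h : IsTransvectionCongr i j c M M') {v : Finset ι} (hv : j ∉ v) {u w : ι}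
    (hu : u ≠ j) (hw : w ≠ j) : pathSum M' v u w = pathSum M v u w := by
  induction v using Finset.strongInduction generalizing u with
  | H v ih =>
    rcases v.eq_empty_or_nonempty with rfl | hne
    · simpa using h.ne_ne u w hu hw
    · rw [pathSum_of_nonempty _ hne, pathSum_of_nonempty _ hne]
      congr 1
      refine sum_congr rfl fun x hx => ?_
      have hxj : x ≠ j := fun e => hv (e ▸ hx)
      rw [h.ne_ne u x hu hxj, ih _ (erase_ssubset hx) (fun e => hv (mem_of_mem_erase e)) hxj]

theorem pathSum_ne_eq (h : IsTransvectionCongr i j c M M') {v : Finset ι} (hv : j ∉ v) {u : ι}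
    (hu : u ≠ j) : pathSum M' v u j = pathSum M v u j + pathSum M v u i * c := by
  induction v using Finset.strongInduction generalizing u with
  | H v ih =>
    rcases v.eq_empty_or_nonempty with rfl | hne
    · simpa using h.ne_eq u hu
    · simp only [pathSum_of_nonempty _ hne]
      rw [neg_mul, ← neg_add, sum_mul, ← sum_add_distrib]
      congr 1
      refine sum_congr rfl fun x hx => ?_
      have hxj : x ≠ j := fun e => hv (e ▸ hx)
      rw [h.ne_ne u x hu hxj, ih _ (erase_ssubset hx) (fun e => hv (mem_of_mem_erase e)) hxj]
      noncomm_ring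

theorem pathSum_eq_eq (h : IsTransvectionCongr i j c M M') {v : Finset ι} (hv : j ∉ v) :
    pathSum M' v j j = pathSum M v j j + pathSum M v j i * c +
      star c * (pathSum M v i j + pathSum M v i i * c) := by
  rcases v.eq_empty_or_nonempty with rfl | hne
  · simpa using h.eq_eq
  · simp only [pathSum_of_nonempty _ hne]
    rw [neg_mul, neg_mul, ← neg_add, ← neg_add, mul_neg, ← neg_add, sum_mul, sum_mul,
      ← sum_add_distrib, ← sum_add_distrib, mul_sum, ← sum_add_distrib]
    congr 1
    refine sum_congr rfl fun x hx => ?_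
    have hxj : x ≠ j := fun e => hv (e ▸ hx)
    rw [h.eq_ne x hxj, h.pathSum_ne_eq (fun e => hv (mem_of_mem_erase e)) hxj]
    noncomm_ring

end IsTransvectionCongr

variable [LinearOrder ι]

theorem IsTransvectionCongr.principalDet_eq_of_notMem {R : Type*} [Ring R] [StarRing R] {i j : ι}
    {c : R} {M M' : Matrix ι ι R} {D D' : Finset ι → R} (h : IsTransvectionCongr i j c M M')
    (hD : IsPrincipalDet M D) (hD' : IsPrincipalDet M' D') {s : Finset ι} (hs : j ∉ s) :
    D' s = D s := by
  induction s using Finset.strong_induction_on_min with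
  | empty => rw [hD.empty, hD'.empty]
  | insert m t hm ih =>
    rw [mem_insert, not_or] at hs
    rw [hD.insert_min m t hm, hD'.insert_min m t hm]
    refine sum_congr rfl fun v hv => ?_
    rw [ih _ sdiff_subset fun e => hs.2 (mem_sdiff.1 e).1,
      h.pathSum_ne_ne (fun e => hs.2 (mem_powerset.1 hv e)) (Ne.symm hs.1) (Ne.symm hs.1)]

/-- Expanded along `j`, the determinant of the transform is sesquilinear in the two ends of the
paths; the three additional terms have an end at the interior vertex `i` and vanish. -/
theorem IsTransvectionCongr.principalDet_eq {i j : ι} {c : ℍ[ℝ]} {M M' : Matrix ι ι ℍ[ℝ]}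
    {D D' : Finset ι → ℍ[ℝ]} (h : IsTransvectionCongr i j c M M') (hij : i ≠ j)
    (hM : M.IsHermitian) (hM' : M'.IsHermitian) (hD : IsPrincipalDet M D)
    (hD' : IsPrincipalDet M' D') {s : Finset ι} (hi : i ∈ s) (hj : j ∈ s) : D' s = D s := by
  obtain ⟨t, hjt, rfl⟩ : ∃ t, j ∉ t ∧ insert j t = s :=
    ⟨s.erase j, notMem_erase _ _, insert_erase hj⟩
  have hit : i ∈ t := mem_of_mem_insert_of_ne hi hij
  have key : borderedSum M' D' t j j = borderedSum M D t j j +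
      ∑ v ∈ t.powerset, pathSum M v j i * c * D (t \ v) +
        star c * (borderedSum M D t i j + ∑ v ∈ t.powerset, pathSum M v i i * c * D (t \ v)) := by
    simp only [borderedSum]
    rw [← sum_add_distrib, ← sum_add_distrib, mul_sum, ← sum_add_distrib]
    refine sum_congr rfl fun v hv => ?_
    rw [h.principalDet_eq_of_notMem hD hD' fun e => hjt (mem_sdiff.1 e).1,
      h.pathSum_eq_eq fun e => hjt (mem_powerset.1 hv e)]
    noncomm_ring
  have hc : ∀ a, ∑ v ∈ t.powerset, pathSum M v a i * c * D (t \ v) =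
      borderedSum M D t a i * c := by
    intro a
    rw [borderedSum, sum_mul]
    refine sum_congr rfl fun v _ => ?_
    rw [mul_assoc, mul_assoc, Quaternion.mul_comm_of_star_eq_self (hD.star_eq hM _)]
  rw [hD.insert_eq hM hjt, hD'.insert_eq hM' hjt, key, hc, hc,
    hD.borderedSum_left_eq_zero hM hit, hD.borderedSum_left_eq_zero hM hit,
    hD.borderedSum_right_eq_zero hM hit]
  simp

/-- Each interior vertex `u` of a path contributes the two adjacent factors `d u * star (d u)`, a
real number. -/
theorem pathSum_diagonal_congr {M M' : Matrix ι ι ℍ[ℝ]} {d : ι → ℍ[ℝ]}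
    (h : ∀ u w, M' u w = star (d u) * M u w * d w) (v : Finset ι) (a b : ι) :
    pathSum M' v a b = (∏ u ∈ v, normSq (d u)) • (star (d a) * pathSum M v a b * d b) := by
  induction v using Finset.strongInduction generalizing a with
  | H v ih =>
    rcases v.eq_empty_or_nonempty with rfl | hne
    · simpa using h a b
    · rw [pathSum_of_nonempty _ hne, pathSum_of_nonempty _ hne, mul_neg, neg_mul, smul_neg,
        mul_sum, sum_mul, smul_sum]
      congr 1
      refine sum_congr rfl fun x hx => ?_
      rw [h, ih _ (erase_ssubset hx), ← mul_prod_erase v _ hx, mul_smul_comm, mul_comm, mul_smul]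
      congr 1
      have h1 : d x * star (d x) = ((normSq (d x) : ℝ) : ℍ[ℝ]) := Quaternion.self_mul_star _
      calc star (d a) * M a x * d x * (star (d x) * pathSum M (v.erase x) x b * d b)
          = star (d a) * M a x * (d x * star (d x)) * pathSum M (v.erase x) x b * d b := by
            noncomm_ring
        _ = _ := by
            rw [h1, ← Quaternion.coe_commutes, Quaternion.coe_mul_eq_smul]
            simp only [smul_mul_assoc, mul_assoc]

theorem IsPrincipalDet.diagonal_congr {M M' : Matrix ι ι ℍ[ℝ]} {D D' : Finset ι → ℍ[ℝ]}
    {d : ι → ℍ[ℝ]} (h : ∀ u w, M' u w = star (d u) * M u w * d w) (hM : M.IsHermitian)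
    (hD : IsPrincipalDet M D) (hD' : IsPrincipalDet M' D') (s : Finset ι) :
    D' s = (∏ u ∈ s, normSq (d u)) • D s := by
  induction s using Finset.strong_induction_on_min with
  | empty => simp [hD.empty, hD'.empty]
  | insert m t hm ih =>
    have hmt : m ∉ t := fun h => lt_irrefl _ (hm m h)
    rw [hD.insert_min m t hm, hD'.insert_min m t hm, borderedSum, borderedSum, smul_sum]
    refine sum_congr rfl fun v hv => ?_
    rw [ih _ sdiff_subset, pathSum_diagonal_congr h, prod_insert hmt,
      ← prod_sdiff (mem_powerset.1 hv), smul_mul_smul_comm, mul_assoc (star (d m)),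
      pathSum_self_mul_comm hM, ← mul_assoc, Quaternion.star_mul_self, mul_assoc,
      Quaternion.coe_mul_eq_smul, smul_smul]
    congr 1
    ring

/-- All the principal determinants of the identity matrix are `1`. -/
theorem IsPrincipalDet.one_eq {R : Type*} [Ring R] {D : Finset ι → R}
    (hD : IsPrincipalDet (1 : Matrix ι ι R) D) (s : Finset ι) : D s = 1 := by
  induction s using Finset.strong_induction_on_min with
  | empty => exact hD.empty
  | insert m t hm ih =>
    have hmt : m ∉ t := fun h => lt_irrefl _ (hm m h)
    rw [hD.insert_min m t hm, borderedSum, sum_eq_single ∅]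
    · simpa using ih t subset_rfl
    · intro v hv hne
      rw [pathSum_of_nonempty _ (nonempty_iff_ne_empty.2 hne), sum_eq_zero, neg_zero, zero_mul]
      intro u hu
      have : m ≠ u := fun e => hmt (e ▸ mem_powerset.1 hv hu)
      simp [Matrix.one_apply_ne this]
    · simp

end Congruence

/-! ### Inserting a point into a cycle of a permutation -/

section PermCycles

open Equiv Function

variable {α : Type*}

theorem Equiv.Perm.minimalPeriod_pos [Finite α] (σ : Perm α) (x : α) : 0 < minimalPeriod σ x :=
  minimalPeriod_pos_of_mem_periodicPts (σ.injective.mem_periodicPts x)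

theorem Equiv.Perm.pow_minimalPeriod_apply (σ : Perm α) (x : α) :
    (σ ^ minimalPeriod σ x) x = x := by
  rw [← Perm.iterate_eq_pow]
  exact iterate_minimalPeriod

theorem Equiv.Perm.sameCycle_iff_exists_pow_lt [Finite α] (σ : Perm α) (x y : α) :
    σ.SameCycle x y ↔ ∃ k < minimalPeriod σ x, (σ ^ k) x = y := by
  constructor
  · intro h
    obtain ⟨k, hk⟩ := h.exists_nat_pow_eq
    refine ⟨k % minimalPeriod σ x, Nat.mod_lt _ (σ.minimalPeriod_pos x), ?_⟩
    rw [← hk, ← Perm.iterate_eq_pow, ← Perm.iterate_eq_pow, iterate_mod_minimalPeriod_eq]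
  · rintro ⟨k, -, hk⟩
    exact ⟨k, by simpa using hk⟩

theorem Equiv.Perm.pow_succ_apply (τ : Perm α) (k : ℕ) (x : α) :
    (τ ^ (k + 1)) x = τ ((τ ^ k) x) := by
  rw [pow_succ', Perm.mul_apply]

theorem Equiv.Perm.minimalPeriod_congr {σ τ : Perm α} {x : α}
    (h : ∀ k : ℕ, (σ ^ k) x = (τ ^ k) x) :
    minimalPeriod σ x = minimalPeriod τ x := by
  rw [minimalPeriod_eq_minimalPeriod_iff]
  intro k
  rw [IsPeriodicPt, IsFixedPt, IsPeriodicPt, IsFixedPt, Perm.iterate_eq_pow, Perm.iterate_eq_pow, h]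

theorem Equiv.Perm.sameCycle_congr [Finite α] {σ τ : Perm α} {x : α}
    (h : ∀ k : ℕ, (σ ^ k) x = (τ ^ k) x)
    (y : α) : σ.SameCycle x y ↔ τ.SameCycle x y := by
  simp only [Perm.sameCycle_iff_exists_pow_lt, Perm.minimalPeriod_congr h, h]

theorem Equiv.Perm.pow_apply_ne_of_apply_eq_self {τ : Perm α} {u : α} (hu : τ u = u)
    {x : α} (hx : x ≠ u) (k : ℕ) :
    (τ ^ k) x ≠ u := by
  intro h
  have h' : (τ ^ k) u = u := Perm.pow_apply_eq_self_of_apply_eq_self hu k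
  exact hx ((τ ^ k).injective (h.trans h'.symm))

variable [DecidableEq α] {τ : Perm α} {u u' : α}

/-- If `τ` fixes `u`, then in `swap u u' * τ` the point `u` is inserted into the cycle of `τ`
through `u'`, immediately before `u'`. -/
theorem Equiv.Perm.swap_mul_pow_succ_apply (hu : τ u = u) (huu' : u' ≠ u) {k : ℕ}
    (hk : k < minimalPeriod τ u') : ((swap u u' * τ) ^ (k + 1)) u = (τ ^ k) u' := by
  induction k with
  | zero => simp [hu]
  | succ k ih =>
    rw [Perm.pow_succ_apply, ih (by omega), Perm.mul_apply, ← Perm.pow_succ_apply]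
    refine swap_apply_of_ne_of_ne (Perm.pow_apply_ne_of_apply_eq_self hu huu' _) fun h => ?_
    rw [← Perm.iterate_eq_pow] at h
    exact not_isPeriodicPt_of_pos_of_lt_minimalPeriod (Nat.succ_ne_zero k) hk h

theorem Equiv.Perm.minimalPeriod_swap_mul [Finite α] (hu : τ u = u) (huu' : u' ≠ u) :
    minimalPeriod (swap u u' * τ) u = minimalPeriod τ u' + 1 := by
  obtain ⟨l, hl⟩ := Nat.exists_eq_succ_of_ne_zero (τ.minimalPeriod_pos u').ne'
  apply le_antisymm
  · refine IsPeriodicPt.minimalPeriod_le (Nat.succ_pos _) ?_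
    rw [IsPeriodicPt, IsFixedPt, Perm.iterate_eq_pow, Perm.pow_succ_apply, hl,
      Perm.swap_mul_pow_succ_apply hu huu' (by omega), Perm.mul_apply, ← Perm.pow_succ_apply,
      ← Nat.succ_eq_add_one, ← hl, Perm.pow_minimalPeriod_apply, swap_apply_right]
  · by_contra! hlt
    obtain ⟨k, hk⟩ := Nat.exists_eq_succ_of_ne_zero
      ((swap u u' * τ).minimalPeriod_pos u).ne'
    have h := (swap u u' * τ).pow_minimalPeriod_apply u
    rw [hk, Nat.succ_eq_add_one, Perm.swap_mul_pow_succ_apply hu huu' (by omega)] at h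
    exact Perm.pow_apply_ne_of_apply_eq_self hu huu' k h

theorem Equiv.Perm.sameCycle_swap_mul_iff [Finite α] (hu : τ u = u) (huu' : u' ≠ u) (x : α) :
    (swap u u' * τ).SameCycle u x ↔ x = u ∨ τ.SameCycle u' x := by
  rw [Perm.sameCycle_iff_exists_pow_lt, Perm.sameCycle_iff_exists_pow_lt,
    Perm.minimalPeriod_swap_mul hu huu']
  constructor
  · rintro ⟨_ | k, hk, rfl⟩
    · simp
    · exact Or.inr ⟨k, by omega, (Perm.swap_mul_pow_succ_apply hu huu' (by omega)).symm⟩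
  · rintro (rfl | ⟨k, hk, rfl⟩)
    · exact ⟨0, by omega, rfl⟩
    · exact ⟨k + 1, by omega, Perm.swap_mul_pow_succ_apply hu huu' hk⟩

theorem Equiv.Perm.swap_mul_pow_apply_of_not_sameCycle (hu : τ u = u) {x : α} (hx : x ≠ u)
    (hxu : ¬ τ.SameCycle u' x) (k : ℕ) : ((swap u u' * τ) ^ k) x = (τ ^ k) x := by
  induction k with
  | zero => rfl
  | succ k ih =>
    rw [Perm.pow_succ_apply, ih, Perm.mul_apply, ← Perm.pow_succ_apply]
    refine swap_apply_of_ne_of_ne (Perm.pow_apply_ne_of_apply_eq_self hu hx _) fun h => hxu ?_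
    exact Perm.SameCycle.symm ⟨(k + 1 : ℕ), by rw [zpow_natCast]; exact h⟩

end PermCycles

/-! ### Row and column determinants as sums over cycles -/

section PermSums

open Equiv Function

variable {R : Type*} [Ring R] {n : ℕ}

/-- The permutations that fix every point outside `s`. -/
def permsFixing (s : Finset (Fin n)) : Finset (Perm (Fin n)) :=
  univ.filter fun σ => ∀ x, x ∉ s → σ x = x

theorem mem_permsFixing {s : Finset (Fin n)} {σ : Perm (Fin n)} :
    σ ∈ permsFixing s ↔ ∀ x, x ∉ s → σ x = x := by
  simp [permsFixing]

/-- The smallest elements of the cycles of `σ` inside `s`, in increasing order. -/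
def cycleLeaders (s : Finset (Fin n)) (σ : Perm (Fin n)) : List (Fin n) :=
  (List.finRange n).filter fun x => x ∈ s ∧ ∀ y, σ.SameCycle x y → x ≤ y

/-- The smallest elements of the cycles of `σ` inside `s` that do not contain `i`, in increasing
order. -/
def otherCycleLeaders (s : Finset (Fin n)) (σ : Perm (Fin n)) (i : Fin n) : List (Fin n) :=
  (List.finRange n).filter fun x => x ∈ s ∧ ¬ σ.SameCycle i x ∧ ∀ y, σ.SameCycle x y → x ≤ y

theorem otherCycleLeaders_univ (σ : Perm (Fin n)) (i : Fin n) :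
    otherCycleLeaders univ σ i = otherLeaders σ i := by
  simp [otherCycleLeaders, otherLeaders]

/-- The product of the entries of `A` along the cycle of `σ` through `u`, written from `u`, with
the column index of the last factor replaced by `b`. -/
noncomputable def openCycleProd (A : Matrix (Fin n) (Fin n) R) (σ : Perm (Fin n))
    (u b : Fin n) : R :=
  ((List.range (minimalPeriod σ u - 1)).map fun k => A ((σ ^ k) u) ((σ ^ (k + 1)) u)).prod *
    A ((σ ^ (minimalPeriod σ u - 1)) u) b

/-- The determinant of the principal submatrix of `A` on the indices in `s`, with the cycles of
every permutation ordered by their smallest elements. -/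
noncomputable def principalDet (A : Matrix (Fin n) (Fin n) R) (s : Finset (Fin n)) : R :=
  ∑ σ ∈ permsFixing s, ((Perm.sign σ : ℤ) : R) * ((cycleLeaders s σ).map (cycleProd A σ)).prod

/-- The `u`-th row determinant of the submatrix of `A` on the indices in `s`, after the `u`-th
column has been replaced by the `b`-th one. -/
noncomputable def rowDetReplace (A : Matrix (Fin n) (Fin n) R) (s : Finset (Fin n))
    (u b : Fin n) : R :=
  ∑ σ ∈ permsFixing s, ((Perm.sign σ : ℤ) : R) *
    (openCycleProd A σ u b * ((otherCycleLeaders s σ u).map (cycleProd A σ)).prod)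

theorem openCycleProd_self (A : Matrix (Fin n) (Fin n) R) (σ : Perm (Fin n)) (u : Fin n) :
    openCycleProd A σ u u = cycleProd A σ u := by
  obtain ⟨l, hl⟩ := Nat.exists_eq_succ_of_ne_zero (σ.minimalPeriod_pos u).ne'
  have h := σ.pow_minimalPeriod_apply u
  rw [hl, Nat.succ_eq_add_one] at h
  rw [openCycleProd, cycleProd, hl, Nat.succ_eq_add_one, Nat.add_sub_cancel, List.range_succ,
    List.map_append, List.prod_append, List.map_singleton, List.prod_singleton, h]

theorem openCycleProd_of_apply_eq_self (A : Matrix (Fin n) (Fin n) R) {σ : Perm (Fin n)}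
    {u : Fin n} (hu : σ u = u) (b : Fin n) : openCycleProd A σ u b = A u b := by
  have : minimalPeriod σ u = 1 := minimalPeriod_eq_one_iff_isFixedPt.2 hu
  simp [openCycleProd, this]

theorem openCycleProd_swap_mul (A : Matrix (Fin n) (Fin n) R) {τ : Perm (Fin n)} {u u' : Fin n}
    (hu : τ u = u) (huu' : u' ≠ u) (b : Fin n) :
    openCycleProd A (swap u u' * τ) u b = A u u' * openCycleProd A τ u' b := by
  obtain ⟨l, hl⟩ := Nat.exists_eq_succ_of_ne_zero (τ.minimalPeriod_pos u').ne'
  have hpow : ∀ k ≤ l, ((swap u u' * τ) ^ (k + 1)) u = (τ ^ k) u' := fun k hk =>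
    Perm.swap_mul_pow_succ_apply hu huu' (by omega)
  rw [openCycleProd, openCycleProd, Perm.minimalPeriod_swap_mul hu huu', hl, Nat.add_sub_cancel,
    Nat.succ_sub_one, Nat.succ_eq_add_one, hpow l le_rfl, List.range_succ_eq_map, List.map_cons,
    List.prod_cons, List.map_map, hpow 0 l.zero_le, mul_assoc]
  congr 3
  refine List.map_congr_left fun k hk => ?_
  have hk' := List.mem_range.1 hk
  simp only [comp_apply, Nat.succ_eq_add_one]
  rw [hpow k (by omega), hpow (k + 1) (by omega)]

theorem cycleProd_congr (A : Matrix (Fin n) (Fin n) R) {σ τ : Perm (Fin n)} {x : Fin n}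
    (h : ∀ k : ℕ, (σ ^ k) x = (τ ^ k) x) : cycleProd A σ x = cycleProd A τ x := by
  simp only [cycleProd, Perm.minimalPeriod_congr h, h]

theorem otherCycleLeaders_swap_mul {s : Finset (Fin n)} {τ : Perm (Fin n)} {u u' : Fin n}
    (hu : τ u = u) (huu' : u' ≠ u) :
    otherCycleLeaders s (swap u u' * τ) u = otherCycleLeaders (s.erase u) τ u' := by
  refine List.filter_congr fun x _ => ?_
  rw [decide_eq_decide, Perm.sameCycle_swap_mul_iff hu huu', mem_erase, not_or]
  by_cases hx : x = u
  · simp [hx]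
  by_cases hxu : τ.SameCycle u' x
  · simp [hxu]
  simp only [Perm.sameCycle_congr (Perm.swap_mul_pow_apply_of_not_sameCycle hu hx hxu)]
  tauto

theorem otherCycleLeaders_of_apply_eq_self {s : Finset (Fin n)} {σ : Perm (Fin n)} {u : Fin n}
    (hu : σ u = u) : otherCycleLeaders s σ u = cycleLeaders (s.erase u) σ := by
  refine List.filter_congr fun x _ => ?_
  have : σ.SameCycle u x ↔ x = u := by
    refine ⟨fun h => ?_, fun h => h ▸ Perm.SameCycle.refl _ _⟩
    obtain ⟨k, hk⟩ := h
    rw [← hk, Perm.zpow_apply_eq_self_of_apply_eq_self hu]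
  rw [decide_eq_decide, mem_erase, this]
  tauto

/-- A permutation `σ` of `s` corresponds to the image `u' = σ u` and the permutation
`τ = swap u u' * σ` of `s.erase u`, which is `σ` with `u` cut out of its cycle. -/
theorem sum_permsFixing {M : Type*} [AddCommMonoid M] {s : Finset (Fin n)} {u : Fin n}
    (hu : u ∈ s) (f : Perm (Fin n) → M) :
    ∑ σ ∈ permsFixing s, f σ = ∑ u' ∈ s, ∑ τ ∈ permsFixing (s.erase u), f (swap u u' * τ) := by
  rw [sum_sigma']
  refine sum_bij' (fun σ _ => ⟨σ u, swap u (σ u) * σ⟩) (fun p _ => swap u p.1 * p.2)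
    ?_ ?_ ?_ ?_ ?_
  · intro σ hσ
    rw [mem_permsFixing] at hσ
    have hσu : σ u ∈ s := by
      by_contra h
      exact h (by rwa [σ.injective (hσ _ h)])
    refine mem_sigma.2 ⟨hσu, mem_permsFixing.2 fun x hx => ?_⟩
    rcases eq_or_ne x u with rfl | hxu
    · simp
    · have hxs : x ∉ s := fun h => hx (mem_erase.2 ⟨hxu, h⟩)
      rw [Perm.mul_apply, hσ x hxs]
      exact swap_apply_of_ne_of_ne hxu fun h => hxs (h ▸ hσu)
  · rintro ⟨u', τ⟩ h
    simp only [mem_sigma, mem_permsFixing] at h ⊢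
    intro x hx
    have hxu : x ≠ u := fun h => hx (h ▸ hu)
    rw [Perm.mul_apply, h.2 x fun h => hx (mem_of_mem_erase h)]
    exact swap_apply_of_ne_of_ne hxu fun h' => hx (h' ▸ h.1)
  · intro σ _
    simp [← mul_assoc]
  · rintro ⟨u', τ⟩ h
    simp only [mem_sigma, mem_permsFixing] at h
    have := h.2 u (notMem_erase u s)
    simp [this, ← mul_assoc]
  · intro σ _
    simp [← mul_assoc]

/-- The same recursion as `borderedSum_eq`: the first step from `u` is split off, and the sign comes
from the transposition that cuts `u` out of its cycle. -/
theorem rowDetReplace_eq (A : Matrix (Fin n) (Fin n) R) {s : Finset (Fin n)} {u : Fin n}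
    (hu : u ∈ s) (b : Fin n) :
    rowDetReplace A s u b = A u b * principalDet A (s.erase u) -
      ∑ u' ∈ s.erase u, A u u' * rowDetReplace A (s.erase u) u' b := by
  rw [rowDetReplace, sum_permsFixing hu, ← add_sum_erase _ _ hu, sub_eq_add_neg,
    ← sum_neg_distrib]
  congr 1
  · rw [principalDet, mul_sum]
    refine sum_congr rfl fun τ hτ => ?_
    have hτu := mem_permsFixing.1 hτ u (notMem_erase u s)
    rw [swap_self, ← Perm.one_def, one_mul, openCycleProd_of_apply_eq_self A hτu,
      otherCycleLeaders_of_apply_eq_self hτu, ← mul_assoc, ← mul_assoc,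
      (Int.cast_commute _ _).eq]
  · refine sum_congr rfl fun u' hu' => ?_
    rw [rowDetReplace, mul_sum, ← sum_neg_distrib]
    refine sum_congr rfl fun τ hτ => ?_
    have hτu := mem_permsFixing.1 hτ u (notMem_erase u s)
    have hne := ne_of_mem_erase hu'
    have hmap : (otherCycleLeaders (s.erase u) τ u').map (cycleProd A (swap u u' * τ)) =
        (otherCycleLeaders (s.erase u) τ u').map (cycleProd A τ) := by
      refine List.map_congr_left fun x hx => cycleProd_congr A ?_
      have hx' := of_decide_eq_true (List.mem_filter.1 hx).2
      exact Perm.swap_mul_pow_apply_of_not_sameCycle hτu (ne_of_mem_erase hx'.1) hx'.2.1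
    rw [openCycleProd_swap_mul A hτu hne, otherCycleLeaders_swap_mul hτu hne, hmap,
      Perm.sign_mul, Perm.sign_swap hne.symm, neg_one_mul, Units.val_neg, Int.cast_neg, neg_mul,
      ← mul_assoc, ← mul_assoc, ← mul_assoc, ← mul_assoc, (Int.cast_commute _ (A u u')).eq]

/-- The row determinant is a sum over all cycles through its base index; each is weighted with the
determinant on the remaining indices. -/
theorem rowDetReplace_eq_borderedSum (A : Matrix (Fin n) (Fin n) R) {s : Finset (Fin n)}
    {u : Fin n} (hu : u ∈ s) (b : Fin n) :
    rowDetReplace A s u b = borderedSum A (principalDet A) (s.erase u) u b := by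
  induction s using Finset.strongInduction generalizing u with
  | H s ih =>
    rw [rowDetReplace_eq A hu, borderedSum_eq]
    congr 1
    exact sum_congr rfl fun u' hu' => by rw [ih _ (erase_ssubset hu) hu']

theorem cycleLeaders_insert_min {m : Fin n} {t : Finset (Fin n)} (hm : ∀ x ∈ t, m < x)
    {σ : Perm (Fin n)} (hσ : σ ∈ permsFixing (insert m t)) :
    cycleLeaders (insert m t) σ = m :: otherCycleLeaders (insert m t) σ m := by
  have hle : ∀ x ∈ insert m t, m ≤ x := by
    intro x hx
    rcases mem_insert.1 hx with rfl | hx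
    · exact le_rfl
    · exact (hm x hx).le
  refine List.Pairwise.eq_of_mem_iff (r := (· < ·))
    ((List.pairwise_lt_finRange n).filter _)
    (List.pairwise_cons.2 ⟨fun x hx => ?_, (List.pairwise_lt_finRange n).filter _⟩) fun x => ?_
  · have hx' := of_decide_eq_true (List.mem_filter.1 hx).2
    refine lt_of_le_of_ne (hle x hx'.1) fun h => hx'.2.1 (h ▸ Perm.SameCycle.refl _ _)
  · simp only [cycleLeaders, otherCycleLeaders, List.mem_filter, List.mem_finRange, true_and,
      List.mem_cons, decide_eq_true_eq]
    constructor
    · rintro ⟨hx, hl⟩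
      by_cases hmx : σ.SameCycle m x
      · exact Or.inl (le_antisymm (hl m hmx.symm) (hle x hx))
      · exact Or.inr ⟨hx, hmx, hl⟩
    · rintro (rfl | ⟨hx, -, hl⟩)
      · refine ⟨mem_insert_self _ _, fun y hy => hle y ?_⟩
        by_contra hys
        obtain ⟨k, hk⟩ := hy.symm
        rw [Perm.zpow_apply_eq_self_of_apply_eq_self (mem_permsFixing.1 hσ y hys)] at hk
        exact hys (hk ▸ mem_insert_self _ _)
      · exact ⟨hx, hl⟩

theorem isPrincipalDet_principalDet (A : Matrix (Fin n) (Fin n) R) :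
    IsPrincipalDet A (principalDet A) where
  empty := by
    have : permsFixing (∅ : Finset (Fin n)) = {1} := by
      ext σ
      simp [mem_permsFixing, Equiv.ext_iff]
    simp [principalDet, this, cycleLeaders]
  insert_min m t hm := by
    have hmt : m ∉ t := fun h => lt_irrefl _ (hm m h)
    have h := rowDetReplace_eq_borderedSum A (mem_insert_self m t) m
    rw [erase_insert hmt] at h
    rw [← h, principalDet, rowDetReplace]
    refine sum_congr rfl fun σ hσ => ?_
    rw [cycleLeaders_insert_min hm hσ, List.map_cons, List.prod_cons, openCycleProd_self]

theorem rdet_eq_borderedSum (A : Matrix (Fin n) (Fin n) R) (i : Fin n) :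
    rdet i A = borderedSum A (principalDet A) (univ.erase i) i i := by
  rw [← rowDetReplace_eq_borderedSum A (mem_univ i), rowDetReplace, rdet]
  have : permsFixing (univ : Finset (Fin n)) = univ := by ext; simp [mem_permsFixing]
  simp only [this, openCycleProd_self, otherCycleLeaders_univ]

theorem star_list_prod [StarRing R] (l : List R) : star l.prod = (l.map star).reverse.prod := by
  induction l with
  | nil => simp
  | cons a l ih => simp [ih]

theorem star_cycleProd [StarRing R] (A : Matrix (Fin n) (Fin n) R) (σ : Perm (Fin n))
    (x : Fin n) : star (cycleProd A σ x) = cycleProd A.conjTranspose σ⁻¹ x := by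
  have hper : minimalPeriod (σ⁻¹ : Perm (Fin n)) x = minimalPeriod σ x := by
    rw [minimalPeriod_eq_minimalPeriod_iff]
    intro k
    rw [IsPeriodicPt, IsFixedPt, IsPeriodicPt, IsFixedPt, Perm.iterate_eq_pow,
      Perm.iterate_eq_pow, inv_pow, Perm.inv_eq_iff_eq, eq_comm]
  have hpow : ∀ k ≤ minimalPeriod σ x,
      (σ ^ (minimalPeriod σ x - k)) x = ((σ⁻¹ : Perm (Fin n)) ^ k) x := by
    intro k hk
    rw [inv_pow, eq_comm, Perm.inv_eq_iff_eq, ← Perm.mul_apply, ← pow_add,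
      Nat.add_sub_cancel' hk, Perm.pow_minimalPeriod_apply]
  rw [cycleProd, cycleProd, hper, star_list_prod, List.map_map, ← List.map_reverse,
    List.range_eq_range', List.reverse_range', List.map_map]
  simp only [← List.range_eq_range']
  congr 1
  refine List.map_congr_left fun k hk => ?_
  have hk' := List.mem_range.1 hk
  have h1 : 0 + minimalPeriod σ x - 1 - k = minimalPeriod σ x - (k + 1) := by omega
  have h2 : minimalPeriod σ x - (k + 1) + 1 = minimalPeriod σ x - k := by omega
  simp only [comp_apply, Matrix.conjTranspose_apply]
  rw [h1, h2, hpow k hk'.le, hpow (k + 1) hk']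

/-- Conjugation reverses the order of the factors and the direction of each cycle; the latter is
undone by replacing `σ` with its inverse. -/
theorem cdet_eq_star_rdet [StarRing R] (A : Matrix (Fin n) (Fin n) R) (i : Fin n) :
    cdet i A = star (rdet i A.conjTranspose) := by
  rw [cdet, rdet, star_sum, ← Equiv.sum_comp (Equiv.inv (Perm (Fin n)))]
  refine sum_congr rfl fun σ _ => ?_
  have hl : otherLeaders σ⁻¹ i = otherLeaders σ i := by
    simp only [otherLeaders, Perm.sameCycle_inv]
  rw [Equiv.inv_apply, Perm.sign_inv, star_mul, star_intCast, star_mul, star_cycleProd,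
    star_list_prod, Matrix.conjTranspose_conjTranspose, hl, (Int.cast_commute _ _).eq,
    List.map_reverse, List.map_map]
  congr 4
  refine List.map_congr_left fun x _ => ?_
  rw [comp_apply, star_cycleProd, Matrix.conjTranspose_conjTranspose]

end PermSums

/-! ### Elimination over a division ring -/

section Elementary

open Matrix

variable {ι : Type*} [Fintype ι] [DecidableEq ι]

theorem Matrix.mul_one_add_single_apply {R : Type*} [Ring R] (M : Matrix ι ι R) (i j : ι) (c : R)
    (a b : ι) : (M * (1 + single i j c)) a b = M a b + if b = j then M a i * c else 0 := by
  rw [mul_add, mul_one, add_apply]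
  congr 1
  split_ifs with h
  · rw [h, mul_single_apply_same]
  · rw [mul_single_apply_of_ne _ _ _ _ _ h]

theorem Matrix.one_add_single_mul_apply {R : Type*} [Ring R] (M : Matrix ι ι R) (i j : ι) (c : R)
    (a b : ι) : ((1 + single i j c) * M) a b = M a b + if a = i then c * M j b else 0 := by
  rw [add_mul, one_mul, add_apply]
  congr 1
  split_ifs with h
  · rw [h, single_mul_apply_same]
  · rw [single_mul_apply_of_ne _ _ _ _ _ h]

theorem Matrix.one_add_single_mul_one_add_single {R : Type*} [Ring R] {i j : ι} (hij : i ≠ j)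
    (c d : R) : (1 + single i j c) * (1 + single i j d) = 1 + single i j (c + d) := by
  rw [mul_add, mul_one, add_mul, one_mul, single_mul_single_of_ne _ _ _ _ hij.symm, single_add]
  abel

variable {K : Type*} [DivisionRing K] {P : Matrix ι ι K → Prop}

/-- A property of products of transvections holds for the matrix that adds multiples of row `k` to
the rows in `S`. -/
theorem Matrix.of_col_operation (h_one : P 1)
    (h_single : ∀ i j, i ≠ j → ∀ c, P (1 + single i j c))
    (h_mul : ∀ A B, P A → P B → P (A * B)) (k : ι) (f : ι → K) {S : Finset ι} (hS : k ∉ S) :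
    P (1 + ∑ i ∈ S, single i k (f i)) := by
  induction S using Finset.induction_on with
  | empty => simpa using h_one
  | insert i S hi ih =>
    rw [Finset.mem_insert, not_or] at hS
    have h := h_mul _ _ (ih hS.2) (h_single i k (Ne.symm hS.1) (f i))
    have h0 : (∑ x ∈ S, single x k (f x)) * single i k (f i) = 0 := by
      rw [Finset.sum_mul]
      exact Finset.sum_eq_zero fun x _ => single_mul_single_of_ne _ _ _ _ hS.1 _
    rwa [add_mul, one_mul, mul_add, mul_one, h0, add_zero, add_assoc,
      ← Finset.sum_insert (f := fun x => single x k (f x)) hi] at h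

/-- A property of products of transvections holds for the matrix that adds multiples of column `k`
to the columns in `S`. -/
theorem Matrix.of_row_operation (h_one : P 1)
    (h_single : ∀ i j, i ≠ j → ∀ c, P (1 + single i j c))
    (h_mul : ∀ A B, P A → P B → P (A * B)) (k : ι) (g : ι → K) {S : Finset ι} (hS : k ∉ S) :
    P (1 + ∑ j ∈ S, single k j (g j)) := by
  induction S using Finset.induction_on with
  | empty => simpa using h_one
  | insert j S hj ih =>
    rw [Finset.mem_insert, not_or] at hS
    have h := h_mul _ _ (h_single k j hS.1 (g j)) (ih hS.2)
    have h0 : single k j (g j) * (∑ x ∈ S, single k x (g x)) = 0 := by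
      rw [Finset.mul_sum]
      exact Finset.sum_eq_zero fun x _ => single_mul_single_of_ne _ _ _ _ (Ne.symm hS.1) _
    rwa [add_mul, one_mul, mul_add, mul_one, h0, add_zero, add_right_comm, add_assoc,
      ← Finset.sum_insert (f := fun x => single k x (g x)) hj] at h

/-- Over a division ring, elimination writes every square matrix as a product of transvections and
diagonal matrices. -/
theorem Matrix.diagonal_transvection_induction_divisionRing
    (h_diag : ∀ d, P (diagonal d))
    (h_single : ∀ i j, i ≠ j → ∀ c, P (1 + single i j c))
    (h_mul : ∀ A B, P A → P B → P (A * B)) (B : Matrix ι ι K) : P B := by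
  have h_one : P 1 := by simpa using h_diag 1
  -- `s` contains the indices whose row and column have not been cleared yet
  suffices H : ∀ (s : Finset ι) (B : Matrix ι ι K),
      (∀ a b, a ≠ b → (a ∉ s ∨ b ∉ s) → B a b = 0) → P B from
    H Finset.univ B (by simp)
  intro s
  induction s using Finset.induction_on with
  | empty =>
    intro B hB
    have : B = diagonal fun a => B a a := by
      ext a b
      by_cases h : a = b
      · simp [h]
      · simp [diagonal_apply_ne _ h, hB a b h]
    rw [this]
    exact h_diag _
  | insert k s hk ih =>
    -- a nonzero pivot clears its row and column
    have pivot : ∀ B : Matrix ι ι K,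
        (∀ a b, a ≠ b → (a ∉ insert k s ∨ b ∉ insert k s) → B a b = 0) → B k k ≠ 0 → P B := by
      intro B hB hkk
      set B' : Matrix ι ι K := of fun a b =>
        if a = k ∨ b = k then (if a = b then B k k else 0)
        else B a b - B a k * (B k k)⁻¹ * B k b with hB'
      have hP : P B' := by
        refine ih B' fun a b hab h => ?_
        simp only [hB', of_apply, if_neg hab]
        split_ifs with hab'
        · rfl
        · rw [not_or] at hab'
          rcases h with h | h
          · have ha : a ∉ insert k s := by simp [hab'.1, h]
            rw [hB a b hab (Or.inl ha), hB a k hab'.1 (Or.inl ha)]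
            simp
          · have hb : b ∉ insert k s := by simp [hab'.2, h]
            rw [hB a b hab (Or.inr hb), hB k b (Ne.symm hab'.2) (Or.inr hb)]
            simp
      have hk' : k ∉ Finset.univ.erase k := Finset.notMem_erase _ _
      have hL := of_col_operation h_one h_single h_mul k (fun a => B a k * (B k k)⁻¹) hk'
      have hR := of_row_operation h_one h_single h_mul k (fun b => (B k k)⁻¹ * B k b) hk'
      convert h_mul _ _ (h_mul _ _ hL hP) hR using 1
      have hmulL : ∀ (X : Matrix ι ι K) (f : ι → K) (a b : ι),
          ((1 + ∑ i ∈ Finset.univ.erase k, single i k (f i)) * X) a b =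
            X a b + if a = k then 0 else f a * X k b := by
        intro X f a b
        rw [add_mul, one_mul, add_apply, Finset.sum_mul, sum_apply]
        congr 1
        split_ifs with ha
        · refine Finset.sum_eq_zero fun i hi => ?_
          rw [single_mul_apply_of_ne]
          exact fun h => Finset.ne_of_mem_erase hi (h.symm.trans ha)
        · rw [Finset.sum_eq_single a, single_mul_apply_same]
          · intro i _ hia
            rw [single_mul_apply_of_ne _ _ _ _ _ (Ne.symm hia)]
          · simp [ha]
      have hmulR : ∀ (X : Matrix ι ι K) (g : ι → K) (a b : ι),
          (X * (1 + ∑ j ∈ Finset.univ.erase k, single k j (g j))) a b =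
            X a b + if b = k then 0 else X a k * g b := by
        intro X g a b
        rw [mul_add, mul_one, add_apply, Finset.mul_sum, sum_apply]
        congr 1
        split_ifs with hb
        · refine Finset.sum_eq_zero fun j hj => ?_
          rw [mul_single_apply_of_ne]
          exact fun h => Finset.ne_of_mem_erase hj (h.symm.trans hb)
        · rw [Finset.sum_eq_single b, mul_single_apply_same]
          · intro j _ hjb
            rw [mul_single_apply_of_ne _ _ _ _ _ (Ne.symm hjb)]
          · simp [hb]
      ext a b
      rw [hmulR, hmulL, hmulL]
      simp only [hB', of_apply]
      by_cases ha : a = k <;> by_cases hb : b = k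
      · simp [ha, hb]
      · simp [ha, hb, Ne.symm hb, hkk]
      · simp [ha, hb, hkk]
      · simp [ha, hb, Ne.symm hb, hkk, mul_assoc]
    intro B hB
    by_cases hkk : B k k = 0
    swap
    · exact pivot B hB hkk
    -- a zero pivot is replaced by adding another row or column
    by_cases hcol : ∃ i, i ≠ k ∧ B i k ≠ 0
    · obtain ⟨i, hik, hi⟩ := hcol
      have his : i ∈ insert k s := by
        by_contra h
        exact hi (hB i k hik (Or.inl h))
      have h1 : P ((1 + single k i 1) * B) := by
        refine pivot _ (fun a b hab h => ?_) ?_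
        · rw [one_add_single_mul_apply, hB a b hab h, zero_add]
          split_ifs with hak
          · have hb : b ∉ insert k s := h.resolve_left (by simp [hak])
            rw [hB i b (fun e => hb (e ▸ his)) (Or.inr hb), mul_zero]
          · rfl
        · simpa [one_add_single_mul_apply, hkk] using hi
      have h2 := h_mul _ _ (h_single k i hik.symm (-1)) h1
      rw [← mul_assoc, one_add_single_mul_one_add_single hik.symm] at h2
      simpa using h2
    by_cases hrow : ∃ j, j ≠ k ∧ B k j ≠ 0
    · obtain ⟨j, hjk, hj⟩ := hrow
      have hjs : j ∈ insert k s := by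
        by_contra h
        exact hj (hB k j hjk.symm (Or.inr h))
      have h1 : P (B * (1 + single j k 1)) := by
        refine pivot _ (fun a b hab h => ?_) ?_
        · rw [mul_one_add_single_apply, hB a b hab h, zero_add]
          split_ifs with hbk
          · have ha : a ∉ insert k s := h.resolve_right (by simp [hbk])
            rw [hB a j (fun e => ha (e ▸ hjs)) (Or.inl ha), zero_mul]
          · rfl
        · simpa [mul_one_add_single_apply, hkk] using hj
      have h2 := h_mul _ _ h1 (h_single j k hjk (-1))
      rw [mul_assoc, one_add_single_mul_one_add_single hjk] at h2
      simpa using h2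
    push Not at hcol hrow
    refine ih B fun a b hab h => ?_
    by_cases ha : a = k
    · subst ha
      exact hrow b (Ne.symm hab)
    by_cases hb : b = k
    · subst hb
      exact hcol a hab
    exact hB a b hab (by simpa [ha, hb] using h)

end Elementary

/-! ### Multiplicativity of the double determinant -/

section Multiplicativity

open Quaternion Matrix

variable {n : ℕ}

theorem principalDet_star_eq_self {M : Matrix (Fin n) (Fin n) ℍ[ℝ]} (hM : M.IsHermitian)
    (s : Finset (Fin n)) : star (principalDet M s) = principalDet M s :=
  (isPrincipalDet_principalDet M).star_eq hM s

theorem rdet_eq_principalDet {M : Matrix (Fin n) (Fin n) ℍ[ℝ]} (hM : M.IsHermitian) (i : Fin n) :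
    rdet i M = principalDet M univ := by
  rw [rdet_eq_borderedSum,
    ← (isPrincipalDet_principalDet M).insert_eq hM (notMem_erase i univ), insert_erase (mem_univ i)]

theorem cdet_eq_principalDet {M : Matrix (Fin n) (Fin n) ℍ[ℝ]} (hM : M.IsHermitian) (i : Fin n) :
    cdet i M = principalDet M univ := by
  rw [cdet_eq_star_rdet, hM.eq, rdet_eq_principalDet hM, principalDet_star_eq_self hM]

theorem principalDet_transvection_congr {M : Matrix (Fin n) (Fin n) ℍ[ℝ]} (hM : M.IsHermitian)
    {i j : Fin n} (hij : i ≠ j) (c : ℍ[ℝ]) :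
    principalDet ((1 + single i j c)ᴴ * M * (1 + single i j c)) univ = principalDet M univ := by
  have hT : (1 + single i j c)ᴴ = 1 + single j i (star c) := by
    rw [conjTranspose_add, conjTranspose_one, conjTranspose_single]
  have h : IsTransvectionCongr i j c M ((1 + single i j c)ᴴ * M * (1 + single i j c)) := by
    constructor
    all_goals intros
    all_goals
      simp_all [mul_one_add_single_apply, one_add_single_mul_apply]
    noncomm_ring
  exact h.principalDet_eq hij hM (isHermitian_conjTranspose_mul_mul _ hM)
    (isPrincipalDet_principalDet _) (isPrincipalDet_principalDet _) (mem_univ i) (mem_univ j)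

theorem principalDet_diagonal_congr {M : Matrix (Fin n) (Fin n) ℍ[ℝ]} (hM : M.IsHermitian)
    (d : Fin n → ℍ[ℝ]) :
    principalDet ((diagonal d)ᴴ * M * diagonal d) univ =
      (∏ u, normSq (d u)) • principalDet M univ := by
  refine IsPrincipalDet.diagonal_congr (d := d) (fun u w => ?_) hM (isPrincipalDet_principalDet _)
    (isPrincipalDet_principalDet _) univ
  rw [mul_diagonal, diagonal_conjTranspose, diagonal_mul, Pi.star_apply]

/-- Congruence by `B` multiplies all Hermitian determinants by one and the same factor. -/
theorem exists_principalDet_congr (B : Matrix (Fin n) (Fin n) ℍ[ℝ]) :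
    ∃ N : ℍ[ℝ], ∀ M : Matrix (Fin n) (Fin n) ℍ[ℝ], M.IsHermitian →
      principalDet (Bᴴ * M * B) univ = principalDet M univ * N := by
  induction B using diagonal_transvection_induction_divisionRing with
  | h_diag d =>
    refine ⟨((∏ u, normSq (d u) : ℝ) : ℍ[ℝ]), fun M hM => ?_⟩
    rw [principalDet_diagonal_congr hM, Quaternion.mul_coe_eq_smul]
  | h_single i j hij c =>
    exact ⟨1, fun M hM => by rw [principalDet_transvection_congr hM hij, mul_one]⟩
  | h_mul A B hA hB =>
    obtain ⟨N, hN⟩ := hA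
    obtain ⟨N', hN'⟩ := hB
    refine ⟨N * N', fun M hM => ?_⟩
    rw [← mul_assoc (principalDet M univ), ← hN M hM,
      ← hN' _ (isHermitian_conjTranspose_mul_mul A hM), conjTranspose_mul]
    simp only [mul_assoc]

theorem principalDet_congr (B : Matrix (Fin n) (Fin n) ℍ[ℝ]) {M : Matrix (Fin n) (Fin n) ℍ[ℝ]}
    (hM : M.IsHermitian) :
    principalDet (Bᴴ * M * B) univ = principalDet M univ * principalDet (Bᴴ * B) univ := by
  obtain ⟨N, hN⟩ := exists_principalDet_congr B
  -- the common factor is found by taking `M = 1`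
  have h := hN 1 isHermitian_one
  rw [mul_one, (isPrincipalDet_principalDet _).one_eq, one_mul] at h
  rw [hN M hM, h]

end Multiplicativity

theorem theorem7p5 (n : ℕ) [NeZero n] :
    (∀ M : Matrix (Fin n) (Fin n) (Quaternion ℝ), M.IsHermitian →
      ∀ i : Fin n, rdet i M = hermitianDet M ∧ cdet i M = hermitianDet M) ∧
    ∀ A B : Matrix (Fin n) (Fin n) (Quaternion ℝ), ddet (A * B) = ddet A * ddet B := by
  refine ⟨fun M hM i => ?_, fun A B => ?_⟩
  · rw [hermitianDet, rdet_eq_principalDet hM, rdet_eq_principalDet hM, cdet_eq_principalDet hM]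
    exact ⟨rfl, rfl⟩
  · have h : ∀ C : Matrix (Fin n) (Fin n) (Quaternion ℝ), (C.conjTranspose * C).IsHermitian :=
      Matrix.isHermitian_conjTranspose_mul_self
    rw [ddet, ddet, ddet, hermitianDet, hermitianDet, hermitianDet, rdet_eq_principalDet (h _),
      rdet_eq_principalDet (h _), rdet_eq_principalDet (h _), ← principalDet_congr B (h A),
      Matrix.conjTranspose_mul]
    simp only [mul_assoc]
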